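/- Let $\mathcal A=(\mathbb A,\mathsf E,\mathsf M)$ be an extensive context: $\mathbb A$ is a finitely complete extensive category with finite coproducts, $(\mathsf E,\mathsf M)$ is a proper factorisation system on $\mathbb A$ (orthogonal, with $\mathsf E$ consisting of epimorphisms and $\mathsf M$ of monomorphisms), and for every object $X$ the poset $\mathrm{Sub}_{\mathsf M}(X)$ of $\mathsf M$-subobjects of $X$ is a complete lattice, with smallest element $\sigma_X$. For a morphism $f$, let $f(p)$ denote the image ($\mathsf M$-part of the $(\mathsf E,\mathsf M)$-factorisation of $f\circ p$) and $f^{-1}(q)$ the preimage (pullback) of $\mathsf M$-subobjects. A preneighbourhood system $\mu$ on $X$ assigns to each $p\in\mathrm{Sub}_{\mathsf M}(X)$ a (possibly improper) filter $\mu(p)$ of the lattice $\mathrm{Sub}_{\mathsf M}(X)$, such that $p\le p'$ implies $\mu(p')\subseteq\mu(p)$, $q\in\mu(p)$ implies $p\le q$, and $\mu(\sigma_X)=\mathrm{Sub}_{\mathsf M}(X)$; systems are ordered by inclusion. A preneighbourhood morphism $f:(X,\mu)\to(Y,\phi)$ is a morphism $f:X\to Y$ such that $q\in\phi(p)$ implies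 $f^{-1}(q)\in\mu(f^{-1}(p))$. In the resulting category $\mathrm{pNHD}(\mathbb A)$ the finite sum of spaces $(X_j,\mu_j)$ is $\coprod_j X_j$ with the largest system making all coproduct injections preneighbourhood morphisms, the initial object is $\emptyset$ with the largest system, and the terminal object is $1$ with the smallest system $\nabla_1$. In a space $(X,\mu)$, call $u$ adherent to $p$ if $v\wedge p\ne\sigma_X$ for all $x\le u$ with $x\neq\sigma_X$ and all $v\in\mu(x)$. The closure of $p$ is the smallest $c\ge p$ that contains every $u$ adherent to $c$; $p$ is closed if it equals its closure. A preneighbourhood morphism is closed if images of closed subobjects are closed, and proper if all its pullbacks in $\mathrm{pNHD}(\mathbb A)$ along preneighbourhood morphisms are closed. A space $(X,\mu)$ is compact if the unique morphism $(X,\mu)\to(1,\nabla_1)$ is proper. **Theorem.** Suppose that every finite sum (in $\mathrm{pNHD}(\mathbb A)$) of closed morphisms is closed. Then every finite sum of proper morphisms is proper. Moreover, every finite sum (including the empty one) of compact spaces is compact if and only if, for every preneighbourhood space $(X,\mu)$, both the unique morphism from the initial space $\emptyset$ to $(X,\mu)$ and the codiagonal $(X,\mu)+(X,\mu)\to(X,\mu)$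 are proper. -/

import Mathlib

open CategoryTheory CategoryTheory.Limits

universe v u

noncomputable section

namespace Preneighbourhood

/-- The data `(A, E, M)` of a context on a category `A`: a proper factorisation system such that
every poset of `M`-subobjects is a complete lattice (every set of `M`-subobjects has a supremum
among the `M`-subobjects).

Since `E` consists of epimorphisms and `M` of monomorphisms, diagonal fill-ins between `E` and `M`
are automatically unique, so that the factorisation system below is an orthogonal one.
A context is *extensive* if `A` has finite limits and is extensive; these are type classes on `A`
below. -/
structure Context (A : Type u) [Category.{v} A] where
  E : MorphismProperty A
  M : MorphismProperty A
  factorisation : MorphismProperty.IsWeakFactorizationSystem E M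
  epi_of_E : ∀ {X Y : A} (f : X ⟶ Y), E f → Epi f
  mono_of_M : ∀ {X Y : A} (f : X ⟶ Y), M f → Mono f
  complete : ∀ (X : A) (S : Set (Subobject X)), (∀ s ∈ S, M s.arrow) →
    ∃ t : Subobject X, M t.arrow ∧ (∀ s ∈ S, s ≤ t) ∧
      ∀ r : Subobject X, M r.arrow → (∀ s ∈ S, s ≤ r) → t ≤ r

section Basic

variable {A : Type u} [Category.{v} A]

/-- The admissible subobjects (`M`-subobjects) of `X`. -/
@[ext]
structure Sub (𝒜 : Context A) (X : A) : Type (max u v) where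
  val : Subobject X
  property : 𝒜.M val.arrow

instance (𝒜 : Context A) (X : A) : PartialOrder (Sub 𝒜 X) :=
  PartialOrder.lift Sub.val fun _ _ => Sub.ext

theorem Sub.exists_isLUB (𝒜 : Context A) (X : A) (S : Set (Sub 𝒜 X)) : ∃ s, IsLUB S s := by
  obtain ⟨t, ht, h1, h2⟩ := 𝒜.complete X (Sub.val '' S) (by rintro _ ⟨s, -, rfl⟩; exact s.2)
  exact ⟨⟨t, ht⟩, fun s hs => h1 _ ⟨s, hs, rfl⟩,
    fun r hr => h2 r.1 r.2 (by rintro _ ⟨s, hs, rfl⟩; exact hr hs)⟩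

instance (𝒜 : Context A) (X : A) : CompleteLattice (Sub 𝒜 X) :=
  letI : SupSet (Sub 𝒜 X) := ⟨fun S => (Sub.exists_isLUB 𝒜 X S).choose⟩
  completeLatticeOfSup _ fun S => (Sub.exists_isLUB 𝒜 X S).choose_spec

instance (𝒜 : Context A) : MorphismProperty.IsWeakFactorizationSystem 𝒜.E 𝒜.M := 𝒜.factorisation

instance (𝒜 : Context A) : 𝒜.M.IsStableUnderBaseChange := by
  rw [← MorphismProperty.rlp_eq_of_wfs 𝒜.E 𝒜.M]; infer_instance

/-- The admissible subobject represented by a morphism in `M`. -/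
def Sub.mk' (𝒜 : Context A) {X Y : A} (m : X ⟶ Y) (hm : 𝒜.M m) : Sub 𝒜 Y :=
  have := 𝒜.mono_of_M m hm
  ⟨Subobject.mk m, by
    have e : (Subobject.mk m).arrow = (Subobject.underlyingIso m).hom ≫ m := by simp
    rw [e]
    exact (MorphismProperty.cancel_left_of_respectsIso 𝒜.M _ _).2 hm⟩

/-- The image `f(p)` of an admissible subobject: the `M`-part of the `(E, M)`-factorisation of
the composite of `p` and `f`. -/
def image {𝒜 : Context A} {X Y : A} (f : X ⟶ Y) (p : Sub 𝒜 X) : Sub 𝒜 Y :=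
  let d := MorphismProperty.factorizationData 𝒜.E 𝒜.M (p.val.arrow ≫ f)
  Sub.mk' 𝒜 d.p d.hp

/-- The preimage `f⁻¹(q)` of an admissible subobject: its pullback along `f`. -/
def preimage {𝒜 : Context A} [HasPullbacks A] {X Y : A} (f : X ⟶ Y) (q : Sub 𝒜 Y) : Sub 𝒜 X :=
  ⟨(Subobject.pullback f).obj q.val,
    MorphismProperty.of_isPullback (Subobject.isPullback f q.val) q.property⟩

variable [HasPullbacks A] {𝒜 : Context A}

theorem preimage_id {X : A} (q : Sub 𝒜 X) : preimage (𝟙 X) q = q :=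
  Sub.ext (Subobject.pullback_id _)

theorem preimage_comp {X Y Z : A} (f : X ⟶ Y) (g : Y ⟶ Z) (q : Sub 𝒜 Z) :
    preimage (f ≫ g) q = preimage f (preimage g q) :=
  Sub.ext (Subobject.pullback_comp _ _ _)

theorem le_preimage_iff {X Y : A} (f : X ⟶ Y) (p : Sub 𝒜 X) (q : Sub 𝒜 Y) :
    p ≤ preimage f q ↔ ∃ k, k ≫ q.val.arrow = p.val.arrow ≫ f := by
  constructor
  · intro h
    have h' : p.val ≤ (Subobject.pullback f).obj q.val := h
    refine ⟨Subobject.ofLE _ _ h' ≫ Subobject.pullbackπ f q.val, ?_⟩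
    rw [Category.assoc, (Subobject.isPullback f q.val).w, ← Category.assoc, Subobject.ofLE_arrow]
  · rintro ⟨k, hk⟩
    refine Subobject.le_of_comm (Y := (Subobject.pullback f).obj q.val)
      ((Subobject.isPullback f q.val).lift k p.val.arrow hk) ?_
    exact (Subobject.isPullback f q.val).lift_snd _ _ _

/-- Taking images is left adjoint to taking preimages. -/
theorem image_preimage_gc {X Y : A} (f : X ⟶ Y) :
    GaloisConnection (image f : Sub 𝒜 X → Sub 𝒜 Y) (preimage f) := by
  intro p q
  rw [le_preimage_iff]
  let d := MorphismProperty.factorizationData 𝒜.E 𝒜.M (p.val.arrow ≫ f)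
  have := 𝒜.mono_of_M _ d.hp
  constructor
  · intro h
    have h' : Subobject.mk d.p ≤ q.val := h
    exact ⟨d.i ≫ Subobject.ofMkLE _ _ h', by simp⟩
  · rintro ⟨k, hk⟩
    have := MorphismProperty.hasLiftingProperty_of_wfs d.i q.val.arrow d.hi q.property
    have sq : CommSq k d.i q.val.arrow d.p := ⟨by rw [hk, d.fac]⟩
    exact Subobject.mk_le_of_comm sq.lift sq.fac_right

theorem preimage_mono {X Y : A} (f : X ⟶ Y) : Monotone (preimage f : Sub 𝒜 Y → Sub 𝒜 X) :=
  (image_preimage_gc f).monotone_u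

theorem preimage_top {X Y : A} (f : X ⟶ Y) : preimage f (⊤ : Sub 𝒜 Y) = ⊤ :=
  (image_preimage_gc f).u_top

theorem preimage_inf {X Y : A} (f : X ⟶ Y) (p q : Sub 𝒜 Y) :
    preimage f (p ⊓ q) = preimage f p ⊓ preimage f q :=
  (image_preimage_gc f).u_inf

/-- A preneighbourhood system on `X`: it assigns to each admissible subobject `p` a filter `nhd p`
in the lattice of admissible subobjects (possibly the improper one) in an order reversing way,
such that every neighbourhood of `p` contains `p`, and such that all admissible subobjects are
neighbourhoods of the smallest one. -/
structure System (𝒜 : Context A) (X : A) where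
  nhd : Sub 𝒜 X → Set (Sub 𝒜 X)
  top_mem : ∀ p, ⊤ ∈ nhd p
  inf_mem : ∀ {p q r}, q ∈ nhd p → r ∈ nhd p → q ⊓ r ∈ nhd p
  mem_of_le : ∀ {p q r}, q ≤ r → q ∈ nhd p → r ∈ nhd p
  antitone : Antitone nhd
  le_of_mem : ∀ {p q}, q ∈ nhd p → p ≤ q
  bot_mem : ⊥ ∈ nhd ⊥

end Basic

section Extensive

variable {A : Type u} [Category.{v} A] [HasFiniteLimits A] [FinitaryExtensive A] {𝒜 : Context A}

/-- In an extensive category, an object receiving an epimorphism from an initial object has a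
morphism to the initial object. -/
theorem exists_to_initial_of_epi {U V : A} (e : U ⟶ V) [Epi e] (a : U ⟶ ⊥_ A) :
    Nonempty (V ⟶ ⊥_ A) := by
  have : IsIso a := inferInstance
  have h : (coprod.inl : V ⟶ V ⨿ V) = coprod.inr := by
    rw [← cancel_epi e, ← cancel_epi (inv a)]
    exact initialIsInitial.hom_ext _ _
  have hp := FinitaryExtensive.isPullback_initial_to_binaryCofan (coprodIsCoprod V V)
  exact ⟨hp.lift (𝟙 V) (𝟙 V) (congrArg (fun t => 𝟙 V ≫ t) h)⟩

theorem M_initial (𝒜 : Context A) (X : A) : 𝒜.M (initial.to X) := by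
  rw [← MorphismProperty.rlp_eq_of_wfs 𝒜.E 𝒜.M]
  intro U V e he
  constructor
  intro a b sq
  have := 𝒜.epi_of_E e he
  obtain ⟨c⟩ := exists_to_initial_of_epi e a
  have : IsIso a := inferInstance
  have : IsIso c := inferInstance
  refine ⟨⟨⟨c, ?_, ?_⟩⟩⟩
  · rw [← cancel_epi (inv a)]; exact initialIsInitial.hom_ext _ _
  · rw [← cancel_epi (inv c)]; exact initialIsInitial.hom_ext _ _

/-- Every morphism of an extensive context reflects zero. -/
theorem preimage_bot {X Y : A} (f : X ⟶ Y) : preimage f (⊥ : Sub 𝒜 Y) = ⊥ := by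
  have h : (⊥ : Sub 𝒜 Y).val ≤ Subobject.mk (initial.to Y) :=
    (bot_le : (⊥ : Sub 𝒜 Y) ≤ Sub.mk' 𝒜 (initial.to Y) (M_initial 𝒜 Y))
  let c : ((Subobject.pullback f).obj (⊥ : Sub 𝒜 Y).val : A) ⟶ ⊥_ A :=
    Subobject.pullbackπ f _ ≫ Subobject.ofLEMk _ _ h
  have : IsIso c := inferInstance
  have key : (Subobject.pullback f).obj (⊥ : Sub 𝒜 Y).val ≤ (⊥ : Sub 𝒜 X).val := by
    refine Subobject.le_of_comm (c ≫ initial.to _) ?_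
    rw [← cancel_epi (inv c)]; exact initialIsInitial.hom_ext _ _
  exact bot_unique key

variable (𝒜) in
/-- Internal preneighbourhood spaces `(X, μ)`. -/
structure Space where
  obj : A
  sys : System 𝒜 obj

/-- Preneighbourhood morphisms: if `q` is a neighbourhood of `p`, then `f⁻¹(q)` is a neighbourhood
of `f⁻¹(p)`. -/
@[ext]
structure Space.Hom (X Y : Space 𝒜) where
  hom : X.obj ⟶ Y.obj
  preimage_mem : ∀ {p q : Sub 𝒜 Y.obj}, q ∈ Y.sys.nhd p →
    preimage hom q ∈ X.sys.nhd (preimage hom p)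

/-- The category `pNHD(A)` of internal preneighbourhood spaces. -/
instance : Category (Space 𝒜) where
  Hom := Space.Hom
  id X := ⟨𝟙 _, fun h => by rwa [preimage_id, preimage_id]⟩
  comp f g := ⟨f.hom ≫ g.hom, fun h => by
    rw [preimage_comp, preimage_comp]; exact f.preimage_mem (g.preimage_mem h)⟩
  id_comp f := Space.Hom.ext (Category.id_comp _)
  comp_id f := Space.Hom.ext (Category.comp_id _)
  assoc f g h := Space.Hom.ext (Category.assoc _ _ _)

theorem Space.hom_ext {X Y : Space 𝒜} {f g : X ⟶ Y} (h : f.hom = g.hom) : f = g :=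
  Space.Hom.ext h

@[simp] theorem Space.comp_hom {X Y Z : Space 𝒜} (f : X ⟶ Y) (g : Y ⟶ Z) :
    (f ≫ g).hom = f.hom ≫ g.hom := rfl

@[simp] theorem Space.id_hom (X : Space 𝒜) : Space.Hom.hom (𝟙 X) = 𝟙 X.obj := rfl

/-- The largest preneighbourhood system on `Y` making given morphisms `ι j : X j ⟶ Y`
preneighbourhood morphisms: `q` is a neighbourhood of `p` if `p ≤ q` and `(ι j)⁻¹(q)` is a
neighbourhood of `(ι j)⁻¹(p)` for all `j`. -/
def finalSystem {J : Type*} (X : J → Space 𝒜) {Y : A} (ι : ∀ j, (X j).obj ⟶ Y) : System 𝒜 Y where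
  nhd p := {q | p ≤ q ∧ ∀ j, preimage (ι j) q ∈ (X j).sys.nhd (preimage (ι j) p)}
  top_mem _ := ⟨le_top, fun j => by rw [preimage_top]; exact (X j).sys.top_mem _⟩
  inf_mem hq hr := ⟨le_inf hq.1 hr.1, fun j => by
    rw [preimage_inf]; exact (X j).sys.inf_mem (hq.2 j) (hr.2 j)⟩
  mem_of_le h hq := ⟨hq.1.trans h, fun j => (X j).sys.mem_of_le (preimage_mono _ h) (hq.2 j)⟩
  antitone _ _ h _ hq :=
    ⟨h.trans hq.1, fun j => (X j).sys.antitone (preimage_mono _ h) (hq.2 j)⟩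
  le_of_mem h := h.1
  bot_mem := ⟨le_rfl, fun j => by rw [preimage_bot]; exact (X j).sys.bot_mem⟩

/-- The finite sum of preneighbourhood spaces: the sum of the underlying objects, with the largest
preneighbourhood system making the injections preneighbourhood morphisms. -/
def Space.sigma {J : Type} [Finite J] (X : J → Space 𝒜) : Space 𝒜 where
  obj := ∐ fun j => (X j).obj
  sys := finalSystem X (Sigma.ι fun j => (X j).obj)

def Space.sigmaι {J : Type} [Finite J] (X : J → Space 𝒜) (j : J) : X j ⟶ Space.sigma X :=
  ⟨Sigma.ι (fun j => (X j).obj) j, fun h => h.2 j⟩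

def Space.sigmaDesc {J : Type} [Finite J] {X : J → Space 𝒜} {Y : Space 𝒜} (f : ∀ j, X j ⟶ Y) :
    Space.sigma X ⟶ Y :=
  ⟨Sigma.desc fun j => (f j).hom, fun {p q} h =>
    ⟨preimage_mono _ (Y.sys.le_of_mem h), fun j => by
      have key (r : Sub 𝒜 Y.obj) : preimage (Sigma.ι (fun j => (X j).obj) j)
          (preimage (Sigma.desc fun j => (f j).hom) r) = preimage (f j).hom r := by
        rw [← preimage_comp, Sigma.ι_desc]
      erw [key q, key p]
      exact (f j).preimage_mem h⟩⟩

/-- `Space.sigma` is the coproduct in the category of preneighbourhood spaces. -/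
def Space.sigmaIsColimit {J : Type} [Finite J] (X : J → Space 𝒜) :
    IsColimit (Cofan.mk (Space.sigma X) (Space.sigmaι X)) :=
  Cofan.IsColimit.mk _ (fun s => Space.sigmaDesc s.inj)
    (fun s j => Space.hom_ext (Sigma.ι_desc _ _))
    (fun s m hm => Space.hom_ext (Sigma.hom_ext _ _ fun j =>
      (congrArg Space.Hom.hom (hm j)).trans
        (Sigma.ι_desc (fun j => (s.inj j).hom) j).symm))

instance {J : Type} [Finite J] (X : J → Space 𝒜) : HasCoproduct X :=
  ⟨⟨⟨_, Space.sigmaIsColimit X⟩⟩⟩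

instance : HasFiniteCoproducts (Space 𝒜) where
  out _ :=
    { has_colimit := fun F =>
        have : HasColimit (Discrete.functor (F.obj ∘ Discrete.mk)) :=
          inferInstanceAs (HasCoproduct (F.obj ∘ Discrete.mk))
        hasColimit_of_iso Discrete.natIsoFunctor }

/-- The smallest preneighbourhood system `∇` on `X`: all admissible subobjects are neighbourhoods
of the smallest one, and the others have only `X` itself as neighbourhood. -/
def smallestSystem (𝒜 : Context A) (X : A) : System 𝒜 X where
  nhd p := {q | p = ⊥ ∨ q = ⊤}
  top_mem _ := Or.inr rfl
  inf_mem := by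
    rintro p q r (h | h) (h' | h')
    exacts [Or.inl h, Or.inl h, Or.inl h', Or.inr (by rw [h, h', inf_top_eq])]
  mem_of_le := by
    rintro p q r hqr (h | rfl)
    exacts [Or.inl h, Or.inr (top_unique hqr)]
  antitone := by
    rintro p p' hp q (rfl | h)
    exacts [Or.inl (bot_unique hp), Or.inr h]
  le_of_mem := by
    rintro p q (rfl | rfl)
    exacts [bot_le, le_top]
  bot_mem := Or.inl rfl

/-- The space `(1, ∇)`. -/
def Space.point (𝒜 : Context A) : Space 𝒜 := ⟨⊤_ A, smallestSystem 𝒜 _⟩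

def Space.toPoint (X : Space 𝒜) : X ⟶ Space.point 𝒜 :=
  ⟨terminal.from _, by
    rintro p q (rfl | rfl)
    · have := preimage_bot (𝒜 := 𝒜) (terminal.from X.obj)
      erw [this]
      exact X.sys.mem_of_le bot_le X.sys.bot_mem
    · have := preimage_top (𝒜 := 𝒜) (terminal.from X.obj)
      erw [this]
      exact X.sys.top_mem _⟩

/-- `(1, ∇)` is the terminal preneighbourhood space. -/
def Space.pointIsTerminal (𝒜 : Context A) : IsTerminal (Space.point 𝒜) :=
  IsTerminal.ofUniqueHom Space.toPoint fun _ _ =>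
    Space.hom_ext (terminalIsTerminal.hom_ext _ _)

instance : HasTerminal (Space 𝒜) := (Space.pointIsTerminal 𝒜).hasTerminal

/-- The smallest preneighbourhood system on `P` making `f : P ⟶ X` and `g : P ⟶ Y`
preneighbourhood morphisms. -/
def initialSystem {P : A} {X Y : Space 𝒜} (f : P ⟶ X.obj) (g : P ⟶ Y.obj) : System 𝒜 P where
  nhd p := {q | p = ⊥ ∨ ∃ s t, ∃ a ∈ X.sys.nhd s, ∃ b ∈ Y.sys.nhd t,
    p ≤ preimage f s ⊓ preimage g t ∧ preimage f a ⊓ preimage g b ≤ q}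
  top_mem _ := Or.inr ⟨⊤, ⊤, ⊤, X.sys.top_mem _, ⊤, Y.sys.top_mem _, by simp [preimage_top], le_top⟩
  inf_mem := by
    rintro p q r (h | ⟨s, t, a, ha, b, hb, h1, h2⟩) (h' | ⟨s', t', a', ha', b', hb', h1', h2'⟩)
    · exact Or.inl h
    · exact Or.inl h
    · exact Or.inl h'
    · refine Or.inr ⟨s ⊓ s', t ⊓ t', a ⊓ a',
        X.sys.inf_mem (X.sys.antitone inf_le_left ha) (X.sys.antitone inf_le_right ha'), b ⊓ b',
        Y.sys.inf_mem (Y.sys.antitone inf_le_left hb) (Y.sys.antitone inf_le_right hb'), ?_, ?_⟩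
      · rw [preimage_inf, preimage_inf, inf_inf_inf_comm]
        exact le_inf h1 h1'
      · rw [preimage_inf, preimage_inf, inf_inf_inf_comm]
        exact inf_le_inf h2 h2'
  mem_of_le := by
    rintro p q r hqr (h | ⟨s, t, a, ha, b, hb, h1, h2⟩)
    exacts [Or.inl h, Or.inr ⟨s, t, a, ha, b, hb, h1, h2.trans hqr⟩]
  antitone := by
    rintro p p' hp q (rfl | ⟨s, t, a, ha, b, hb, h1, h2⟩)
    exacts [Or.inl (bot_unique hp), Or.inr ⟨s, t, a, ha, b, hb, hp.trans h1, h2⟩]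
  le_of_mem := by
    rintro p q (rfl | ⟨s, t, a, ha, b, hb, h1, h2⟩)
    · exact bot_le
    · exact (h1.trans (inf_le_inf (preimage_mono _ (X.sys.le_of_mem ha))
        (preimage_mono _ (Y.sys.le_of_mem hb)))).trans h2
  bot_mem := Or.inl rfl

/-- The category of preneighbourhood spaces has pullbacks: they are pullbacks in `A`, with the
smallest preneighbourhood system making the projections preneighbourhood morphisms. -/
theorem Space.exists_isPullback {X Y Z : Space 𝒜} (f : X ⟶ Z) (g : Y ⟶ Z) {P : A}
    {fst : P ⟶ X.obj} {snd : P ⟶ Y.obj} (h : IsPullback fst snd f.hom g.hom) :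
    ∃ (a : (⟨P, initialSystem fst snd⟩ : Space 𝒜) ⟶ X)
      (b : (⟨P, initialSystem fst snd⟩ : Space 𝒜) ⟶ Y),
      a.hom = fst ∧ b.hom = snd ∧ IsPullback a b f g := by
  refine ⟨⟨fst, fun {p q} hq => Or.inr ⟨p, ⊤, q, hq, ⊤, Y.sys.top_mem _, by simp [preimage_top],
    by simp [preimage_top]⟩⟩, ⟨snd, fun {p q} hq => Or.inr ⟨⊤, p, ⊤, X.sys.top_mem _, q, hq,
    by simp [preimage_top], by simp [preimage_top]⟩⟩, rfl, rfl, ⟨Space.hom_ext h.w⟩, ⟨?_⟩⟩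
  refine PullbackCone.IsLimit.mk _
    (fun s => ⟨h.lift s.fst.hom s.snd.hom (congrArg Space.Hom.hom s.condition), ?_⟩)
    (fun s => Space.hom_ext (h.lift_fst _ _ _)) (fun s => Space.hom_ext (h.lift_snd _ _ _))
    (fun s m h1 h2 => Space.hom_ext (h.hom_ext
      ((congrArg Space.Hom.hom h1).trans (h.lift_fst _ _ _).symm)
      ((congrArg Space.Hom.hom h2).trans (h.lift_snd _ _ _).symm)))
  have e := congrArg Space.Hom.hom s.condition
  rintro p q (rfl | ⟨u, t, a, ha, b, hb, h1, h2⟩)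
  · have := preimage_bot (𝒜 := 𝒜) (h.lift s.fst.hom s.snd.hom e)
    erw [this]
    exact s.pt.sys.mem_of_le bot_le s.pt.sys.bot_mem
  · refine s.pt.sys.antitone (preimage_mono _ h1) (s.pt.sys.mem_of_le (preimage_mono _ h2) ?_)
    rw [preimage_inf, preimage_inf, ← preimage_comp, ← preimage_comp, ← preimage_comp,
      ← preimage_comp, h.lift_fst, h.lift_snd]
    exact s.pt.sys.inf_mem (s.pt.sys.antitone inf_le_left (s.fst.preimage_mem ha))
      (s.pt.sys.antitone inf_le_right (s.snd.preimage_mem hb))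

/-- `u` is adherent to `p` if all neighbourhoods of all non-zero parts of `u` meet `p`. -/
def System.Adherent {X : A} (μ : System 𝒜 X) (p u : Sub 𝒜 X) : Prop :=
  ∀ x ≤ u, x ≠ ⊥ → ∀ v ∈ μ.nhd x, v ⊓ p ≠ ⊥

/-- The closure of `p`: the smallest admissible subobject above `p` that contains every admissible
subobject adherent to it. -/
def System.closure {X : A} (μ : System 𝒜 X) (p : Sub 𝒜 X) : Sub 𝒜 X :=
  sInf {c | p ≤ c ∧ ∀ u, μ.Adherent c u → u ≤ c}

/-- Closed admissible subobjects: those that are equal to their closure. -/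
def System.IsClosed {X : A} (μ : System 𝒜 X) (p : Sub 𝒜 X) : Prop :=
  μ.closure p = p

theorem System.isClosed_iff {X : A} (μ : System 𝒜 X) (p : Sub 𝒜 X) :
    μ.IsClosed p ↔ ∀ u, μ.Adherent p u → u ≤ p := by
  constructor
  · intro h u hu
    rw [← h]
    refine le_sInf fun c hc => hc.2 u fun x hx h0 v hv hb => hu x hx h0 v hv ?_
    exact bot_unique (hb ▸ inf_le_inf_left v hc.1)
  · intro h
    exact le_antisymm (sInf_le ⟨le_rfl, h⟩) (le_sInf fun _ hc => hc.1)

/-- The closure is idempotent. -/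
theorem System.isClosed_closure {X : A} (μ : System 𝒜 X) (p : Sub 𝒜 X) :
    μ.IsClosed (μ.closure p) :=
  (μ.isClosed_iff _).2 fun u hu => le_sInf fun _ hc => hc.2 u fun x hx h0 v hv hb =>
    hu x hx h0 v hv (bot_unique (hb ▸ inf_le_inf_left v (sInf_le hc)))

/-- Closed morphisms: preneighbourhood morphisms that preserve closed subobjects. -/
def closedMorphisms (𝒜 : Context A) : MorphismProperty (Space 𝒜) :=
  fun X Y f => ∀ c : Sub 𝒜 X.obj, X.sys.IsClosed c → Y.sys.IsClosed (image f.hom c)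

/-- Proper morphisms: those all of whose pullbacks along preneighbourhood morphisms, in the
category of preneighbourhood spaces, are closed. -/
def properMorphisms (𝒜 : Context A) : MorphismProperty (Space 𝒜) :=
  (closedMorphisms 𝒜).universally

/-- A space is compact if its unique morphism to the terminal space `(1, ∇)` is proper. -/
def Space.IsCompact (X : Space 𝒜) : Prop :=
  properMorphisms 𝒜 (terminal.from X)

end Extensive

end Preneighbourhood

end

set_option linter.unusedSectionVars false

namespace Preneighbourhood

section

variable {A : Type u} [Category.{v} A] [HasFiniteLimits A] [FinitaryExtensive A] {𝒜 : Context A}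

/-! Let `g : Z ⟶ ∐ Y` be a morphism of spaces. By extensivity the object `Z` is the sum of the
pullbacks `W j` of the summands, but `Z` need not carry the sum system. The point is that it has the
same closed subobjects as the sum (`isClosed_preimage_sigmaDesc_iff`). Adherence is tested on all
non-zero parts of `u`, so a part may be shrunk to a non-zero trace on one `W j`; there every
neighbourhood in `W j` comes from one in `Z`, because summands are open
(`mem_nhd_of_isPullback_sigmaι`).

Closedness of a morphism depends only on closed subobjects. Hence a pullback of a sum of proper
morphisms is closed as soon as the sum of the pulled back morphisms is, and this sum is closed by
hypothesis (`properMorphisms_sigmaMap`).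

In the same way every pullback of a codiagonal behaves like the codiagonal of the new base
(`closedMorphisms_fold_iff`). So all binary codiagonals are proper once that of `1` is, which is
compactness of `1 + 1`. Conversely, the map from a sum of two compact spaces to `1` is a proper map
to `1 + 1` followed by a proper codiagonal; induction gives finite sums. The initial object is
strict and `⊥` is always closed, so the empty case is automatic. -/

instance (𝒜 : Context A) : 𝒜.M.IsMultiplicative := by
  rw [← MorphismProperty.rlp_eq_of_wfs 𝒜.E 𝒜.M]; infer_instance

/-! ### Zero subobjects, images and preimages -/

theorem Sub.eq_bot_of_hom_initial {X : A} (p : Sub 𝒜 X) (c : (p.val : A) ⟶ ⊥_ A) : p = ⊥ := by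
  have : IsIso c := inferInstance
  have key : p.val ≤ (⊥ : Sub 𝒜 X).val := by
    refine Subobject.le_of_comm (c ≫ initial.to _) ?_
    rw [← cancel_epi (inv c)]; exact initialIsInitial.hom_ext _ _
  exact bot_unique key

theorem Sub.nonempty_bot_hom_initial (X : A) :
    Nonempty (((⊥ : Sub 𝒜 X).val : A) ⟶ ⊥_ A) :=
  ⟨Subobject.ofLEMk _ _
    (bot_le : (⊥ : Sub 𝒜 X) ≤ Sub.mk' 𝒜 (initial.to X) (M_initial 𝒜 X))⟩

/-- Allows an inequality to be checked on the domain of the smaller subobject, where its arrow can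
be factored through other objects. -/
theorem preimage_arrow_eq_top_iff {X : A} (p q : Sub 𝒜 X) :
    preimage p.val.arrow q = ⊤ ↔ p ≤ q := by
  rw [← top_le_iff, le_preimage_iff]
  constructor
  · rintro ⟨k, hk⟩
    have h1 : 𝒜.M (𝟙 (p.val : A)) := MorphismProperty.id_mem _ _
    have h : Sub.mk' 𝒜 (𝟙 _) h1 ≤ ⊤ := le_top
    have h' : Subobject.mk (𝟙 (p.val : A)) ≤ (⊤ : Sub 𝒜 (p.val : A)).val := h
    refine Subobject.le_of_comm (Subobject.ofMkLE _ _ h' ≫ k) ?_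
    rw [Category.assoc, hk, ← Category.assoc, Subobject.ofMkLE_arrow, Category.id_comp]
  · intro h
    have h' : p.val ≤ q.val := h
    exact ⟨(⊤ : Sub 𝒜 (p.val : A)).val.arrow ≫ Subobject.ofLE _ _ h', by simp⟩

theorem preimage_eq_top {X Y : A} {f : X ⟶ Y} {q : Sub 𝒜 Y} (k : X ⟶ (q.val : A))
    (hk : k ≫ q.val.arrow = f) : preimage f q = ⊤ := by
  rw [← top_le_iff, le_preimage_iff]
  exact ⟨(⊤ : Sub 𝒜 X).val.arrow ≫ k, by rw [Category.assoc, hk]⟩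

theorem image_ne_bot {X Y : A} (f : X ⟶ Y) {p : Sub 𝒜 X} (hp : p ≠ ⊥) : image f p ≠ ⊥ := by
  intro h
  have := (image_preimage_gc f p ⊥).1 h.le
  rw [preimage_bot] at this
  exact hp (bot_unique this)

theorem image_comp {X Y Z : A} (f : X ⟶ Y) (g : Y ⟶ Z) (p : Sub 𝒜 X) :
    image (f ≫ g) p = image g (image f p) :=
  eq_of_forall_ge_iff fun q => by
    rw [image_preimage_gc (f ≫ g), image_preimage_gc g, image_preimage_gc f, preimage_comp]

theorem image_id {X : A} (p : Sub 𝒜 X) : image (𝟙 X) p = p :=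
  eq_of_forall_ge_iff fun q => by rw [image_preimage_gc (𝟙 X), preimage_id]

/-- Taking preimages along an isomorphism. -/
noncomputable def preimageIso {X Y : A} (e : X ≅ Y) : Sub 𝒜 Y ≃o Sub 𝒜 X where
  toFun := preimage e.hom
  invFun := preimage e.inv
  left_inv q := by rw [← preimage_comp, e.inv_hom_id, preimage_id]
  right_inv q := by rw [← preimage_comp, e.hom_inv_id, preimage_id]
  map_rel_iff' {p q} := by
    refine ⟨fun h => ?_, fun h => preimage_mono _ h⟩
    have := preimage_mono e.inv h
    simp only [Equiv.coe_fn_mk] at this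
    rwa [← preimage_comp, ← preimage_comp, e.inv_hom_id, preimage_id, preimage_id] at this

theorem preimage_eq_bot_iff {X Y : A} (f : X ⟶ Y) [IsIso f] {q : Sub 𝒜 Y} :
    preimage f q = ⊥ ↔ q = ⊥ :=
  map_eq_bot_iff (preimageIso (asIso f))

theorem preimage_surjective {X Y : A} (f : X ⟶ Y) [IsIso f] :
    Function.Surjective (preimage f : Sub 𝒜 Y → Sub 𝒜 X) :=
  (preimageIso (asIso f)).surjective

theorem preimage_le_preimage_iff {X Y : A} (f : X ⟶ Y) [IsIso f] {p q : Sub 𝒜 Y} :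
    preimage f p ≤ preimage f q ↔ p ≤ q :=
  (preimageIso (asIso f)).le_iff_le

theorem image_preimage_of_isIso {X Y : A} (f : X ⟶ Y) [IsIso f] (q : Sub 𝒜 Y) :
    image f (preimage f q) = q :=
  eq_of_forall_ge_iff fun r => by rw [image_preimage_gc f, preimage_le_preimage_iff]

/-! ### Subobjects of finite sums -/

/-- Coproduct injections of an extensive context are admissible. -/
theorem M_sigma_ι (𝒜 : Context A) {J : Type} [Finite J] (Y : J → A) (j : J) :
    𝒜.M (Sigma.ι Y j) := by
  rw [← MorphismProperty.rlp_eq_of_wfs 𝒜.E 𝒜.M]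
  intro U V e he
  constructor
  intro a b sq
  have := 𝒜.epi_of_E e he
  -- `χ` records the summand. Since `e` is epi and `e ≫ b` lies over `j`, all of `b` lies over `j`.
  let χ : (∐ Y) ⟶ ∐ fun _ : J => ⊤_ A := Limits.Sigma.map fun _ => terminal.from _
  have hχ (k : J) : Sigma.ι Y k ≫ χ = terminal.from _ ≫ Sigma.ι (fun _ : J => ⊤_ A) k := by
    simp [χ]
  have hb : b ≫ χ = terminal.from V ≫ Sigma.ι (fun _ : J => ⊤_ A) j := by
    rw [← cancel_epi e, ← Category.assoc, ← sq.w, Category.assoc, hχ, ← Category.assoc,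
      ← Category.assoc]
    congr 1
    exact terminalIsTerminal.hom_ext _ _
  have hV := FinitaryPreExtensive.isIso_sigmaDesc_fst (Sigma.ι Y) b
    (by rw [show Sigma.desc (Sigma.ι Y) = 𝟙 _ from Sigma.hom_ext _ _ (by simp)]; infer_instance)
  have hk (k : J) : ∃ l : pullback b (Sigma.ι Y k) ⟶ Y j,
      l ≫ Sigma.ι Y j = pullback.fst _ _ ≫ b := by
    by_cases h : k = j
    · subst h
      exact ⟨pullback.snd _ _, pullback.condition.symm⟩
    -- The part of `V` over a summand `k ≠ j` lies over two different copies of `1`, which are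
    -- disjoint, so it is initial.
    · let c : pullback b (Sigma.ι Y k) ⟶ ⊥_ A :=
        (FinitaryExtensive.isPullback_initial_to_sigma_ι (fun _ : J => ⊤_ A) k j h).lift
          (terminal.from _) (terminal.from _) (by
            have h1 : pullback.fst b (Sigma.ι Y k) ≫ b ≫ χ = _ :=
              congrArg (pullback.fst b (Sigma.ι Y k) ≫ ·) hb
            rw [pullback.condition_assoc, hχ, ← Category.assoc, ← Category.assoc] at h1
            convert h1 using 2 <;> exact terminalIsTerminal.hom_ext _ _)
      have : IsIso c := inferInstance
      exact ⟨c ≫ initial.to _, by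
        rw [← cancel_epi (inv c)]; exact initialIsInitial.hom_ext _ _⟩
  choose l hl using hk
  let d := inv (Sigma.desc fun k => pullback.fst b (Sigma.ι Y k)) ≫ Sigma.desc l
  have hd : d ≫ Sigma.ι Y j = b := by
    rw [Category.assoc, IsIso.inv_comp_eq]
    refine Sigma.hom_ext _ _ fun k => ?_
    simp [hl]
  refine ⟨⟨⟨d, ?_, hd⟩⟩⟩
  rw [← cancel_mono (Sigma.ι Y j), Category.assoc, hd, sq.w]

/-- A non-zero subobject meets one of the summands. -/
theorem exists_preimage_ne_bot {J : Type} [Finite J] {W : J → A} {Z : A} (z : ∀ j, W j ⟶ Z)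
    (hz : IsIso (Sigma.desc z)) {x : Sub 𝒜 Z} (hx : x ≠ ⊥) : ∃ j, preimage (z j) x ≠ ⊥ := by
  by_contra! h
  -- The domain of `x` is the sum of its traces; if all of these are initial, so is the domain.
  have hV := FinitaryPreExtensive.isIso_sigmaDesc_fst z x.val.arrow hz
  have hk (k : J) : Nonempty (pullback x.val.arrow (z k) ⟶ ⊥_ A) := by
    have hp := Subobject.isPullback (z k) x.val
    let l := hp.lift (pullback.fst x.val.arrow (z k)) (pullback.snd _ _) pullback.condition
    have e : ((Subobject.pullback (z k)).obj x.val) = (⊥ : Sub 𝒜 (W k)).val :=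
      congrArg Sub.val (h k)
    obtain ⟨c⟩ := Sub.nonempty_bot_hom_initial (𝒜 := 𝒜) (W k)
    exact ⟨l ≫ Subobject.ofLE _ _ e.le ≫ c⟩
  let l (k : J) := (hk k).some
  exact hx (x.eq_bot_of_hom_initial
    (inv (Sigma.desc fun k => pullback.fst x.val.arrow (z k)) ≫ Sigma.desc l))

/-- The image of an admissible subobject under a coproduct injection. -/
noncomputable def Sub.sigmaMk {J : Type} [Finite J] {Y : J → A} (j : J) (t : Sub 𝒜 (Y j)) :
    Sub 𝒜 (∐ Y) :=
  Sub.mk' 𝒜 (t.val.arrow ≫ Sigma.ι Y j)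
    (MorphismProperty.comp_mem _ _ _ t.property (M_sigma_ι 𝒜 Y j))

theorem Sub.exists_sigmaMk_arrow {J : Type} [Finite J] {Y : J → A} (j : J) (t : Sub 𝒜 (Y j)) :
    ∃ k : ((Sub.sigmaMk j t).val : A) ⟶ (t.val : A),
      k ≫ t.val.arrow ≫ Sigma.ι Y j = (Sub.sigmaMk j t).val.arrow := by
  have := 𝒜.mono_of_M _
    (MorphismProperty.comp_mem _ _ _ t.property (M_sigma_ι 𝒜 Y j))
  exact ⟨(Subobject.underlyingIso (t.val.arrow ≫ Sigma.ι Y j)).hom,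
    Subobject.underlyingIso_hom_comp_eq_mk _⟩

theorem Sub.sigmaMk_mono {J : Type} [Finite J] {Y : J → A} (j : J) :
    Monotone (Sub.sigmaMk j : Sub 𝒜 (Y j) → Sub 𝒜 (∐ Y)) := by
  intro t b h
  have := 𝒜.mono_of_M _
    (MorphismProperty.comp_mem _ _ _ t.property (M_sigma_ι 𝒜 Y j))
  have := 𝒜.mono_of_M _
    (MorphismProperty.comp_mem _ _ _ b.property (M_sigma_ι 𝒜 Y j))
  have h' : t.val ≤ b.val := h
  have key : Subobject.mk (t.val.arrow ≫ Sigma.ι Y j) ≤ Subobject.mk (b.val.arrow ≫ Sigma.ι Y j) :=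
    Subobject.mk_le_mk_of_comm (Subobject.ofLE _ _ h') (by simp)
  exact key

theorem preimage_sigmaMk_self {J : Type} [Finite J] {Y : J → A} (j : J) (t : Sub 𝒜 (Y j)) :
    preimage (Sigma.ι Y j) (Sub.sigmaMk j t) = t := by
  apply le_antisymm
  · obtain ⟨k, hk⟩ := Sub.exists_sigmaMk_arrow j t
    have hp := Subobject.isPullback (Sigma.ι Y j) (Sub.sigmaMk j t).val
    have key : (Subobject.pullback (Sigma.ι Y j)).obj (Sub.sigmaMk j t).val ≤ t.val := by
      refine Subobject.le_of_comm (Subobject.pullbackπ _ _ ≫ k) ?_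
      rw [← cancel_mono (Sigma.ι Y j), Category.assoc, Category.assoc, hk, hp.w]
    exact key
  · have := 𝒜.mono_of_M _
      (MorphismProperty.comp_mem _ _ _ t.property (M_sigma_ι 𝒜 Y j))
    exact (le_preimage_iff _ _ _).2
      ⟨(Subobject.underlyingIso (t.val.arrow ≫ Sigma.ι Y j)).inv, Subobject.underlyingIso_arrow _⟩

theorem preimage_sigmaMk_of_ne {J : Type} [Finite J] {Y : J → A} {j k : J} (h : k ≠ j)
    (t : Sub 𝒜 (Y j)) : preimage (Sigma.ι Y k) (Sub.sigmaMk j t) = ⊥ := by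
  obtain ⟨l, hl⟩ := Sub.exists_sigmaMk_arrow j t
  have hp := Subobject.isPullback (Sigma.ι Y k) (Sub.sigmaMk j t).val
  refine Sub.eq_bot_of_hom_initial _
    ((FinitaryExtensive.isPullback_initial_to_sigma_ι Y k j h).lift
      (Subobject.arrow _)
      (Subobject.pullbackπ (Sigma.ι Y k) (Sub.sigmaMk j t).val ≫ l ≫ t.val.arrow) ?_)
  have e : Subobject.pullbackπ (Sigma.ι Y k) (Sub.sigmaMk j t).val ≫
      (Sub.sigmaMk j t).val.arrow = (Subobject.pullbackπ (Sigma.ι Y k) (Sub.sigmaMk j t).val ≫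
      l ≫ t.val.arrow) ≫ Sigma.ι Y j := by
    rw [Category.assoc, Category.assoc, hl]
  exact hp.w.symm.trans e

/-- Summands are open: on the other summands both traces are `⊥`, and `⊥` is a neighbourhood of `⊥`.
-/
theorem sigmaMk_mem_nhd {J : Type} [Finite J] {Y : J → Space 𝒜} (j : J)
    {t b : Sub 𝒜 (Y j).obj} (h : b ∈ (Y j).sys.nhd t) :
    (Sub.sigmaMk j b : Sub 𝒜 (Space.sigma Y).obj) ∈ (Space.sigma Y).sys.nhd (Sub.sigmaMk j t) := by
  refine ⟨Sub.sigmaMk_mono j ((Y j).sys.le_of_mem h), fun k => ?_⟩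
  by_cases hk : k = j
  · subst hk
    rwa [preimage_sigmaMk_self, preimage_sigmaMk_self]
  · rw [preimage_sigmaMk_of_ne hk, preimage_sigmaMk_of_ne hk]
    exact (Y k).sys.bot_mem


/-! ### Pullbacks of spaces and comparison of closed subobjects -/

instance : HasPullbacks (Space 𝒜) :=
  have (X Y Z : Space 𝒜) (f : X ⟶ Z) (g : Y ⟶ Z) : HasPullback f g := by
    obtain ⟨a, b, -, -, h⟩ := Space.exists_isPullback f g (IsPullback.of_hasPullback f.hom g.hom)
    exact h.hasPullback
  hasPullbacks_of_hasLimit_cospan _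

theorem Space.isPullback_hom {W X Y Z : Space 𝒜} {a : W ⟶ X} {b : W ⟶ Y} {f : X ⟶ Z} {g : Y ⟶ Z}
    (h : IsPullback a b f g) : IsPullback a.hom b.hom f.hom g.hom := by
  obtain ⟨a', b', ha', hb', h'⟩ :=
    Space.exists_isPullback f g (IsPullback.of_hasPullback f.hom g.hom)
  let e := h.isoIsPullback _ _ h'
  let e' : W.obj ≅ pullback f.hom g.hom :=
    ⟨e.hom.hom, e.inv.hom, congrArg Space.Hom.hom e.hom_inv_id,
      congrArg Space.Hom.hom e.inv_hom_id⟩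
  refine IsPullback.of_iso_pullback ⟨congrArg Space.Hom.hom h.w⟩ e' ?_ ?_
  · rw [← ha']; exact congrArg Space.Hom.hom (h.isoIsPullback_hom_fst _ _ h')
  · rw [← hb']; exact congrArg Space.Hom.hom (h.isoIsPullback_hom_snd _ _ h')

/-- Pullbacks carry the initial preneighbourhood system. -/
theorem Space.mem_initialSystem_of_isPullback {W X Y Z : Space 𝒜} {a : W ⟶ X} {b : W ⟶ Y}
    {f : X ⟶ Z} {g : Y ⟶ Z} (h : IsPullback a b f g) {p q : Sub 𝒜 W.obj}
    (hq : q ∈ W.sys.nhd p) : q ∈ (initialSystem a.hom b.hom).nhd p := by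
  have hA := Space.isPullback_hom h
  obtain ⟨a', b', ha', hb', h'⟩ := Space.exists_isPullback f g hA
  let l := h.lift a' b' h'.w
  -- The comparison from the initial system to `W` is the identity on objects of `A`; that it is a
  -- preneighbourhood morphism is the claim.
  have hl : l.hom = 𝟙 W.obj := hA.hom_ext
    ((congrArg Space.Hom.hom (h.lift_fst a' b' h'.w)).trans
      (ha'.trans (Category.id_comp _).symm))
    ((congrArg Space.Hom.hom (h.lift_snd a' b' h'.w)).trans
      (hb'.trans (Category.id_comp _).symm))
  have key := l.preimage_mem hq
  rw [hl] at key
  erw [preimage_id, preimage_id] at key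
  exact key

theorem System.isClosed_bot {X : A} (μ : System 𝒜 X) : μ.IsClosed ⊥ :=
  (μ.isClosed_iff _).2 fun u hu => by
    by_contra h
    exact hu u le_rfl (fun h0 => h h0.le) ⊤ (μ.top_mem _) (inf_bot_eq _)

/-- A bijective preneighbourhood morphism preserves and reflects closed subobjects if every
non-zero admissible subobject of its codomain has a non-zero part at which it reflects
neighbourhoods. -/
theorem isClosed_preimage_iff {Z' Z : Space 𝒜} (φ : Z' ⟶ Z) [IsIso φ.hom]
    (H : ∀ x : Sub 𝒜 Z.obj, x ≠ ⊥ → ∃ x' ≤ x, x' ≠ ⊥ ∧ ∀ v : Sub 𝒜 Z.obj,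
      preimage φ.hom v ∈ Z'.sys.nhd (preimage φ.hom x) → v ∈ Z.sys.nhd x')
    (c : Sub 𝒜 Z.obj) : Z'.sys.IsClosed (preimage φ.hom c) ↔ Z.sys.IsClosed c := by
  rw [System.isClosed_iff, System.isClosed_iff, (preimage_surjective φ.hom).forall]
  refine forall_congr' fun u => ?_
  rw [preimage_le_preimage_iff]
  refine imp_congr_left ⟨fun hu x hx h0 v hv => ?_, fun hu => ?_⟩
  · have := hu (preimage φ.hom x) (preimage_mono _ hx) (mt (preimage_eq_bot_iff _).1 h0)
      (preimage φ.hom v) (φ.preimage_mem hv)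
    rw [← preimage_inf] at this
    exact fun h => this ((preimage_eq_bot_iff _).2 h)
  · unfold System.Adherent
    rw [(preimage_surjective φ.hom).forall]
    intro x hx h0
    rw [(preimage_surjective φ.hom).forall]
    intro v hv
    rw [preimage_le_preimage_iff] at hx
    -- Adherence of `u` may be applied to the smaller part `x'` in place of `x`, since `x'` is again
    -- a non-zero part of `u`.
    obtain ⟨x', hx', h0', hv'⟩ := H x (mt (preimage_eq_bot_iff _).2 h0)
    rw [← preimage_inf]
    exact mt (preimage_eq_bot_iff _).1 (hu x' (hx'.trans hx) h0' v (hv' v hv))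

theorem preimage_sigmaι_preimage_sigmaDesc {J : Type} [Finite J] {W : J → Space 𝒜} {Z : Space 𝒜}
    (z : ∀ j, W j ⟶ Z) (j : J) (q : Sub 𝒜 Z.obj) :
    preimage (Space.sigmaι W j).hom (preimage (Space.sigmaDesc z).hom q) =
      preimage (z j).hom q := by
  rw [← preimage_comp]
  exact congrArg (preimage · q) (Sigma.ι_desc (fun j => (z j).hom) j)

/-- Universality of finite sums, for arbitrary choices of the pullbacks. -/
theorem isIso_sigmaDesc_of_isPullback {J : Type} [Finite J] {W Y : J → A} {Z : A} {g : Z ⟶ ∐ Y}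
    {z : ∀ j, W j ⟶ Z} {y : ∀ j, W j ⟶ Y j} (h : ∀ j, IsPullback (z j) (y j) g (Sigma.ι Y j)) :
    IsIso (Sigma.desc z) := by
  have hY := FinitaryPreExtensive.isIso_sigmaDesc_fst (Sigma.ι Y) g
    (by rw [show Sigma.desc (Sigma.ι Y) = 𝟙 _ from Sigma.hom_ext _ _ (by simp)]; infer_instance)
  have : Sigma.desc z = (Limits.Sigma.mapIso fun j => (h j).isoPullback).hom ≫
      Sigma.desc fun j => pullback.fst g (Sigma.ι Y j) :=
    Sigma.hom_ext _ _ fun j => by simp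
  rw [this]
  infer_instance

/-! ### Spaces over a finite sum -/

section Decomposition

variable {J : Type} [Finite J] {Y : J → Space 𝒜} {Z : Space 𝒜} {g : Z ⟶ Space.sigma Y}
  {W : J → Space 𝒜} {z : ∀ j, W j ⟶ Z} {y : ∀ j, W j ⟶ Y j}
  (h : ∀ j, IsPullback (z j) (y j) g (Space.sigmaι Y j))

include h

/-- The system on the pullback `W j` is generated by neighbourhoods from `Z` and from `Y j`. The
latter extend by zero to neighbourhoods in the sum, and these pull back along `g` to neighbourhoods
in `Z`. -/
theorem mem_nhd_of_isPullback_sigmaι (j : J) {x v : Sub 𝒜 Z.obj}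
    (hx : preimage (z j).hom x ≠ ⊥)
    (hv : preimage (z j).hom v ∈ (W j).sys.nhd (preimage (z j).hom x)) :
    v ∈ Z.sys.nhd (image (z j).hom (preimage (z j).hom x)) := by
  have hA := Space.isPullback_hom (h j)
  rcases Space.mem_initialSystem_of_isPullback (h j) hv with h0 |
    ⟨s, t, a, ha, b, hb, h1, h2⟩
  · exact absurd h0 hx
  let T : Sub 𝒜 (Space.sigma Y).obj := Sub.sigmaMk (Y := fun j => (Y j).obj) j t
  let B : Sub 𝒜 (Space.sigma Y).obj := Sub.sigmaMk j b
  have hB : preimage g.hom B ∈ Z.sys.nhd (preimage g.hom T) :=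
    g.preimage_mem (sigmaMk_mem_nhd j hb)
  have hT : preimage (z j).hom (preimage g.hom T) = preimage (y j).hom t := by
    rw [← preimage_comp, hA.w, preimage_comp]
    exact congrArg _ (preimage_sigmaMk_self (Y := fun j => (Y j).obj) j t)
  refine Z.sys.antitone (a := image (z j).hom (preimage (z j).hom x))
    (b := s ⊓ preimage g.hom T) ?_ (Z.sys.mem_of_le (q := a ⊓ preimage g.hom B) ?_ ?_)
  · rw [image_preimage_gc, preimage_inf, hT]
    exact h1
  -- As `B` is supported on the summand `j`, the arrow of `r` factors through `z j`; the inequality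
  -- `r ≤ v` can then be checked in `W j`, where it is `h2`.
  · set r := a ⊓ preimage g.hom B with hr
    obtain ⟨k, hk⟩ := (le_preimage_iff g.hom r B).1 inf_le_right
    obtain ⟨k', hk'⟩ : ∃ k' : (B.val : A) ⟶ (b.val : A),
        (k' ≫ b.val.arrow) ≫ (Space.sigmaι Y j).hom = B.val.arrow := by
      obtain ⟨k', hk'⟩ := Sub.exists_sigmaMk_arrow (Y := fun j => (Y j).obj) j b
      exact ⟨k', (Category.assoc _ _ _).trans hk'⟩
    have e : r.val.arrow ≫ g.hom = (k ≫ k' ≫ b.val.arrow) ≫ (Space.sigmaι Y j).hom := by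
      rw [← hk, ← hk', Category.assoc, Category.assoc, Category.assoc]
    have l1 := hA.lift_fst _ _ e
    have l2 := hA.lift_snd _ _ e
    rw [← preimage_arrow_eq_top_iff, ← top_le_iff, ← l1, preimage_comp]
    refine le_trans ?_ (preimage_mono _ h2)
    rw [preimage_inf, ← preimage_comp, ← preimage_comp, l1, l2]
    refine le_inf ?_ ?_
    · rw [(preimage_arrow_eq_top_iff r a).2 inf_le_left]
    · rw [preimage_eq_top (k ≫ k') (Category.assoc _ _ _)]
  · exact Z.sys.inf_mem (Z.sys.antitone inf_le_left ha) (Z.sys.antitone inf_le_right hB)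

theorem isIso_sigmaDesc_hom_of_isPullback : IsIso (Space.sigmaDesc z).hom :=
  isIso_sigmaDesc_of_isPullback fun j => Space.isPullback_hom (h j)

/-- A space over a finite sum has the same closed subobjects as the sum of its parts. -/
theorem isClosed_preimage_sigmaDesc_iff (c : Sub 𝒜 Z.obj) :
    (Space.sigma W).sys.IsClosed (preimage (Space.sigmaDesc z).hom c) ↔ Z.sys.IsClosed c := by
  have := isIso_sigmaDesc_hom_of_isPullback h
  refine isClosed_preimage_iff _ (fun x hx => ?_) c
  -- The smaller part of `x` is the image of a non-zero trace on one `W j`.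
  obtain ⟨j, hj⟩ := exists_preimage_ne_bot (fun j => (z j).hom) this hx
  refine ⟨_, (image_preimage_gc (z j).hom).l_u_le x, image_ne_bot _ hj, fun v hv => ?_⟩
  refine mem_nhd_of_isPullback_sigmaι h j hj ?_
  rw [← preimage_sigmaι_preimage_sigmaDesc, ← preimage_sigmaι_preimage_sigmaDesc z]
  exact hv.2 j

end Decomposition


/-! ### Closed and proper morphisms -/

theorem closedMorphisms_comp_left_iff {Z' Z Y : Space 𝒜} (φ : Z' ⟶ Z) [IsIso φ.hom]
    (hφ : ∀ c, Z'.sys.IsClosed (preimage φ.hom c) ↔ Z.sys.IsClosed c) (f : Z ⟶ Y) :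
    closedMorphisms 𝒜 (φ ≫ f) ↔ closedMorphisms 𝒜 f := by
  unfold closedMorphisms
  rw [(preimage_surjective φ.hom).forall]
  refine forall_congr' fun c => ?_
  rw [hφ, Space.comp_hom, image_comp, image_preimage_of_isIso]

theorem closedMorphisms_comp_right_iff {X Z' Z : Space 𝒜} (f : X ⟶ Z') (φ : Z' ⟶ Z) [IsIso φ.hom]
    (hφ : ∀ c, Z'.sys.IsClosed (preimage φ.hom c) ↔ Z.sys.IsClosed c) :
    closedMorphisms 𝒜 (f ≫ φ) ↔ closedMorphisms 𝒜 f := by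
  unfold closedMorphisms
  refine forall_congr' fun c => imp_congr_right fun _ => ?_
  obtain ⟨d, hd⟩ := preimage_surjective φ.hom (image f.hom c)
  rw [Space.comp_hom, image_comp, ← hd, image_preimage_of_isIso, hφ]

instance : (closedMorphisms 𝒜).IsStableUnderComposition where
  comp_mem f g hf hg c hc := by
    rw [Space.comp_hom, image_comp]
    exact hg _ (hf c hc)

theorem isIso_hom {X Y : Space 𝒜} (e : X ≅ Y) : IsIso e.hom.hom :=
  ⟨e.inv.hom, congrArg Space.Hom.hom e.hom_inv_id, congrArg Space.Hom.hom e.inv_hom_id⟩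

theorem isClosed_preimage_iso_iff {X Y : Space 𝒜} (e : X ≅ Y) (c : Sub 𝒜 Y.obj) :
    X.sys.IsClosed (preimage e.hom.hom c) ↔ Y.sys.IsClosed c := by
  have := isIso_hom e
  have h (q : Sub 𝒜 Y.obj) : preimage e.inv.hom (preimage e.hom.hom q) = q := by
    rw [← preimage_comp, ← Space.comp_hom, e.inv_hom_id, Space.id_hom, preimage_id]
  refine isClosed_preimage_iff _ (fun x hx => ⟨x, le_rfl, hx, fun v hv => ?_⟩) c
  have := e.inv.preimage_mem hv
  rwa [h, h] at this

instance : (closedMorphisms 𝒜).RespectsIso :=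
  MorphismProperty.RespectsIso.mk _
    (fun e f hf => by
      have := isIso_hom e
      exact (closedMorphisms_comp_left_iff e.hom (isClosed_preimage_iso_iff e) f).2 hf)
    (fun e f hf => by
      have := isIso_hom e
      exact (closedMorphisms_comp_right_iff f e.hom (isClosed_preimage_iso_iff e)).2 hf)

instance : (properMorphisms 𝒜).RespectsIso :=
  inferInstanceAs (closedMorphisms 𝒜).universally.RespectsIso

instance : (properMorphisms 𝒜).IsStableUnderComposition :=
  inferInstanceAs (closedMorphisms 𝒜).universally.IsStableUnderComposition

instance : (closedMorphisms 𝒜).ContainsIdentities where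
  id_mem X c hc := by rwa [Space.id_hom, image_id]

theorem properMorphisms_of_isIso {X Y : Space 𝒜} (f : X ⟶ Y) [IsIso f] :
    properMorphisms 𝒜 f := fun _ _ _ _ f' h => by
  have : IsIso f' := h.isIso_fst_of_isIso
  exact MorphismProperty.of_isIso _ f'

/-! ### Sums of proper morphisms -/

theorem Space.sigmaι_desc {J : Type} [Finite J] {X : J → Space 𝒜} {Y : Space 𝒜}
    (f : ∀ j, X j ⟶ Y) (j : J) : Space.sigmaι X j ≫ Space.sigmaDesc f = f j :=
  Space.hom_ext (Sigma.ι_desc (fun j => (f j).hom) j)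

theorem Space.sigma_hom_ext {J : Type} [Finite J] {X : J → Space 𝒜} {Y : Space 𝒜}
    {f g : Space.sigma X ⟶ Y} (h : ∀ j, Space.sigmaι X j ≫ f = Space.sigmaι X j ≫ g) : f = g :=
  Space.hom_ext (Sigma.hom_ext _ _ fun j => congrArg Space.Hom.hom (h j))

/-- The sum of preneighbourhood morphisms. -/
noncomputable def Space.sigmaMap {J : Type} [Finite J] {X Y : J → Space 𝒜} (f : ∀ j, X j ⟶ Y j) :
    Space.sigma X ⟶ Space.sigma Y :=
  Space.sigmaDesc fun j => f j ≫ Space.sigmaι Y j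

noncomputable def Space.sigmaIso {J : Type} [Finite J] (X : J → Space 𝒜) : ∐ X ≅ Space.sigma X :=
  (coproductIsCoproduct X).coconePointUniqueUpToIso (Space.sigmaIsColimit X)

theorem Space.ι_sigmaIso {J : Type} [Finite J] (X : J → Space 𝒜) (j : J) :
    Sigma.ι X j ≫ (Space.sigmaIso X).hom = Space.sigmaι X j :=
  (coproductIsCoproduct X).comp_coconePointUniqueUpToIso_hom (Space.sigmaIsColimit X) ⟨j⟩

theorem Space.map_sigmaIso {J : Type} [Finite J] {X Y : J → Space 𝒜} (f : ∀ j, X j ⟶ Y j) :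
    Limits.Sigma.map f ≫ (Space.sigmaIso Y).hom = (Space.sigmaIso X).hom ≫ Space.sigmaMap f :=
  Sigma.hom_ext _ _ fun j => by
    rw [← Category.assoc, Sigma.ι_map, Category.assoc, Space.ι_sigmaIso, ← Category.assoc,
      Space.ι_sigmaIso, Space.sigmaMap, Space.sigmaι_desc]

theorem sigma_map_iff_sigmaMap (P : MorphismProperty (Space 𝒜)) [P.RespectsIso] {J : Type}
    [Finite J] {X Y : J → Space 𝒜} (f : ∀ j, X j ⟶ Y j) :
    P (Limits.Sigma.map f) ↔ P (Space.sigmaMap f) := by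
  rw [← P.cancel_right_of_respectsIso _ (Space.sigmaIso Y).hom, Space.map_sigmaIso,
    P.cancel_left_of_respectsIso]

/-- Finite sums of proper morphisms are proper if finite sums of closed morphisms are closed. -/
theorem properMorphisms_sigmaMap {J : Type} [Finite J]
    (H : ∀ (X Y : J → Space 𝒜) (f : ∀ j, X j ⟶ Y j), (∀ j, closedMorphisms 𝒜 (f j)) →
      closedMorphisms 𝒜 (Space.sigmaMap f))
    {X Y : J → Space 𝒜} {f : ∀ j, X j ⟶ Y j} (hf : ∀ j, properMorphisms 𝒜 (f j)) :
    properMorphisms 𝒜 (Space.sigmaMap f) := by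
  intro P Z gP g k hk
  let W (j : J) := pullback g (Space.sigmaι Y j)
  let z (j : J) : W j ⟶ Z := pullback.fst _ _
  let y (j : J) : W j ⟶ Y j := pullback.snd _ _
  have hW (j : J) : IsPullback (z j) (y j) g (Space.sigmaι Y j) := IsPullback.of_hasPullback _ _
  let Q (j : J) := pullback (y j) (f j)
  let k' (j : J) : Q j ⟶ W j := pullback.fst _ _
  let x (j : J) : Q j ⟶ X j := pullback.snd _ _
  have hQ (j : J) : IsPullback (k' j) (x j) (y j) (f j) := IsPullback.of_hasPullback _ _
  have hs (j : J) : Space.sigmaι X j ≫ Space.sigmaMap f = f j ≫ Space.sigmaι Y j :=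
    Space.sigmaι_desc _ j
  -- Pasting the squares over `f j` and over the injection of `Y j`. Cancelling `hk` from the result
  -- then identifies `Q j` with the part of `P` over `X j`.
  have hQZ (j : J) : IsPullback (x j) (k' j ≫ z j) (Space.sigmaι X j ≫ Space.sigmaMap f) g := by
    rw [hs]
    exact (hQ j).flip.paste_vert (hW j).flip
  let p (j : J) : Q j ⟶ P := hk.lift (k' j ≫ z j) (x j ≫ Space.sigmaι X j)
    ((hQZ j).w.symm.trans (Category.assoc _ _ _).symm)
  have hpk (j : J) : p j ≫ k = k' j ≫ z j := hk.lift_fst _ _ _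
  have hpg (j : J) : p j ≫ gP = x j ≫ Space.sigmaι X j := hk.lift_snd _ _ _
  have hP (j : J) : IsPullback (p j) (x j) gP (Space.sigmaι X j) :=
    (IsPullback.of_bot (by rw [hpk]; exact hQZ j) (hpg j).symm hk.flip).flip
  have comm : Space.sigmaDesc p ≫ k = Space.sigmaMap k' ≫ Space.sigmaDesc z :=
    Space.sigma_hom_ext fun j => by
      rw [← Category.assoc, ← Category.assoc, Space.sigmaι_desc, hpk, Space.sigmaMap,
        Space.sigmaι_desc, Category.assoc, Space.sigmaι_desc]
  have := isIso_sigmaDesc_hom_of_isPullback hP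
  have := isIso_sigmaDesc_hom_of_isPullback hW
  -- Both `P` and `Z` are replaced by the sums of their parts, which turns `k` into the sum of the
  -- `k' j`.
  rw [← closedMorphisms_comp_left_iff _ (isClosed_preimage_sigmaDesc_iff hP), comm,
    closedMorphisms_comp_right_iff _ _ (isClosed_preimage_sigmaDesc_iff hW)]
  exact H _ _ _ fun j => hf j _ _ _ (hQ j)

/-! ### Codiagonals -/

/-- The codiagonal of a finite sum of copies of a space. -/
noncomputable abbrev Space.fold (J : Type) [Finite J] (X : Space 𝒜) :
    Space.sigma (fun _ : J => X) ⟶ X :=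
  Space.sigmaDesc fun _ => 𝟙 X

/-- Up to closed subobjects, codiagonals are stable under pullback. -/
theorem closedMorphisms_fold_iff {J : Type} [Finite J] {X Y K : Space 𝒜} {h : Y ⟶ X} {k : K ⟶ Y}
    {g : K ⟶ Space.sigma fun _ : J => X} (hk : IsPullback k g h (Space.fold J X)) :
    closedMorphisms 𝒜 k ↔ closedMorphisms 𝒜 (Space.fold J Y) := by
  have hfold (j : J) : Space.sigmaι (fun _ : J => X) j ≫ Space.fold J X = 𝟙 X :=
    Space.sigmaι_desc _ j
  -- `z j` is the section of `k` over the copy `j`; by cancellation of pullbacks it exhibits `Y` as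
  -- the part of `K` over that copy.
  let z (j : J) : Y ⟶ K := hk.lift (𝟙 Y) (h ≫ Space.sigmaι (fun _ : J => X) j) (by
    rw [Category.id_comp, Category.assoc, hfold, Category.comp_id])
  have hzk (j : J) : z j ≫ k = 𝟙 Y := hk.lift_fst _ _ _
  have hzg (j : J) : z j ≫ g = h ≫ Space.sigmaι (fun _ : J => X) j := hk.lift_snd _ _ _
  have hz (j : J) : IsPullback (z j) h g (Space.sigmaι (fun _ : J => X) j) :=
    (IsPullback.of_bot (by rw [hzk, hfold]; exact IsPullback.of_vert_isIso ⟨by simp⟩)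
      (hzg j).symm hk.flip).flip
  have comm : Space.sigmaDesc z ≫ k = Space.fold J Y :=
    Space.sigma_hom_ext fun j => by
      rw [← Category.assoc, Space.sigmaι_desc, Space.sigmaι_desc, hzk]
  have := isIso_sigmaDesc_hom_of_isPullback hz
  rw [← comm, closedMorphisms_comp_left_iff _ (isClosed_preimage_sigmaDesc_iff hz)]

/-- Closedness of a pullback to `Y` of a codiagonal depends only on `Y`, so it can be tested by
pulling back the codiagonal of `T` along `Y ⟶ T`. -/
theorem properMorphisms_fold {J : Type} [Finite J] {T : Space 𝒜} (hT : IsTerminal T)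
    (h : properMorphisms 𝒜 (Space.fold J T)) (X : Space 𝒜) :
    properMorphisms 𝒜 (Space.fold J X) := fun _ Y _ _ _ hk =>
  (closedMorphisms_fold_iff hk).2 ((closedMorphisms_fold_iff
    (IsPullback.of_hasPullback (hT.from Y) (Space.fold J T))).1
      (h _ _ _ (IsPullback.of_hasPullback _ _)))

noncomputable def Space.coprodIso (X : Space 𝒜) : X ⨿ X ≅ Space.sigma fun _ : Bool => X where
  hom := coprod.desc (Space.sigmaι (fun _ : Bool => X) true)
    (Space.sigmaι (fun _ : Bool => X) false)
  inv := Space.sigmaDesc fun b => if b then coprod.inl else coprod.inr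
  hom_inv_id := by
    ext <;> simp [Space.sigmaι_desc]
  inv_hom_id := Space.sigma_hom_ext fun b => by
    rw [← Category.assoc, Space.sigmaι_desc, Category.comp_id]
    cases b
    exacts [coprod.inr_desc _ _, coprod.inl_desc _ _]

theorem properMorphisms_codiag_iff (X : Space 𝒜) :
    properMorphisms 𝒜 (codiag X) ↔ properMorphisms 𝒜 (Space.fold Bool X) := by
  have he : codiag X = (Space.coprodIso X).hom ≫ Space.fold Bool X := by
    ext <;> simp [Space.coprodIso, Space.sigmaι_desc]
  rw [he, (properMorphisms 𝒜).cancel_left_of_respectsIso]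

/-! ### Compactness of finite sums -/

/-- The domain of any pullback of `f` also maps to the strict initial object, so its only subobject
is `⊥`, whose image `⊥` is closed. -/
theorem properMorphisms_of_hom_initial {X Y : Space 𝒜} (c : X.obj ⟶ ⊥_ A) (f : X ⟶ Y) :
    properMorphisms 𝒜 f := by
  intro P Z a _ k _ s _
  have : s = ⊥ := Sub.eq_bot_of_hom_initial _ (s.val.arrow ≫ a.hom ≫ c)
  rw [this, (image_preimage_gc k.hom).l_bot]
  exact Z.sys.isClosed_bot

theorem properMorphisms_initial_to (X : Space 𝒜) : properMorphisms 𝒜 (initial.to X) :=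
  properMorphisms_of_hom_initial
    -- The initial space is only known up to isomorphism; the empty sum links it to the initial
    -- object of `A`.
    ((initial.to (Space.sigma (PEmpty.elim : PEmpty → Space 𝒜))).hom ≫
      Limits.Sigma.desc fun j => PEmpty.elim j) _

theorem Space.isCompact_iff {X T : Space 𝒜} (hT : IsTerminal T) (f : X ⟶ T) :
    X.IsCompact ↔ properMorphisms 𝒜 f := by
  have : terminal.from X = f ≫ (hT.uniqueUpToIso terminalIsTerminal).hom :=
    terminalIsTerminal.hom_ext _ _
  rw [Space.IsCompact, this, (properMorphisms 𝒜).cancel_right_of_respectsIso]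

theorem Space.isCompact_congr {X Y : Space 𝒜} (e : X ≅ Y) : X.IsCompact ↔ Y.IsCompact := by
  rw [Space.IsCompact, ← terminal.comp_from e.hom, (properMorphisms 𝒜).cancel_left_of_respectsIso]
  rfl

/-- Sums of two compact spaces, as sums over a type with two elements. -/
theorem Space.isCompact_sigma_bool
    (H : ∀ (X Y : Bool → Space 𝒜) (f : ∀ j, X j ⟶ Y j), (∀ j, properMorphisms 𝒜 (f j)) →
      properMorphisms 𝒜 (Space.sigmaMap f))
    (h : properMorphisms 𝒜 (Space.fold Bool (⊤_ Space 𝒜))) {X : Bool → Space 𝒜}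
    (hX : ∀ j, (X j).IsCompact) : (Space.sigma X).IsCompact := by
  have := MorphismProperty.comp_mem (properMorphisms 𝒜) _ _
    (H X (fun _ => ⊤_ Space 𝒜) (fun j => terminal.from (X j)) hX) h
  exact (Space.isCompact_iff terminalIsTerminal _).2 this

noncomputable def Space.sigmaOptionIso {J : Type} [Finite J] (X : Option J → Space 𝒜) :
    Space.sigma (fun b : Bool => if b then Space.sigma (fun j => X (some j)) else X none) ≅
      Space.sigma X where
  hom := Space.sigmaDesc fun
    | true => Space.sigmaDesc fun j => Space.sigmaι X (some j)
    | false => Space.sigmaι X none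
  inv := Space.sigmaDesc fun
    | some j => Space.sigmaι (fun j => X (some j)) j ≫ Space.sigmaι
        (fun b : Bool => if b then Space.sigma (fun j => X (some j)) else X none) true
    | none => Space.sigmaι
        (fun b : Bool => if b then Space.sigma (fun j => X (some j)) else X none) false
  hom_inv_id := Space.sigma_hom_ext fun b => by
    rw [← Category.assoc, Space.sigmaι_desc, Category.comp_id]
    cases b
    · exact Space.sigmaι_desc _ _
    · refine Space.sigma_hom_ext fun j => ?_
      refine (Category.assoc _ _ _).symm.trans ?_
      rw [Space.sigmaι_desc]
      exact Space.sigmaι_desc _ _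
  inv_hom_id := Space.sigma_hom_ext fun b => by
    rw [← Category.assoc, Space.sigmaι_desc, Category.comp_id]
    cases b
    · exact Space.sigmaι_desc _ _
    · refine (Category.assoc _ _ _).trans ?_
      rw [Space.sigmaι_desc]
      exact Space.sigmaι_desc _ _

noncomputable def Space.sigmaEquivIso {I J : Type} [Finite I] [Finite J] (e : I ≃ J)
    (X : J → Space 𝒜) : Space.sigma (fun i => X (e i)) ≅ Space.sigma X :=
  (Space.sigmaIso _).symm ≪≫ Sigma.whiskerEquiv e (fun _ => Iso.refl _) ≪≫ Space.sigmaIso _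

/-- Induction on the index type, adjoining one summand at a time by a binary sum. -/
theorem Space.isCompact_sigma
    (H : ∀ (X Y : Bool → Space 𝒜) (f : ∀ j, X j ⟶ Y j), (∀ j, properMorphisms 𝒜 (f j)) →
      properMorphisms 𝒜 (Space.sigmaMap f))
    (h : properMorphisms 𝒜 (Space.fold Bool (⊤_ Space 𝒜))) (J : Type) [Finite J] :
    ∀ X : J → Space 𝒜, (∀ j, (X j).IsCompact) → (Space.sigma X).IsCompact := by
  suffices ∀ [Finite J] (X : J → Space 𝒜), (∀ j, (X j).IsCompact) → (Space.sigma X).IsCompact from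
    this
  refine Finite.induction_empty_option (P := fun J => ∀ [Finite J] (X : J → Space 𝒜),
    (∀ j, (X j).IsCompact) → (Space.sigma X).IsCompact) ?_ ?_ ?_ J
  · intro I J e hI _ X hX
    have := Finite.of_equiv J e.symm
    exact (Space.isCompact_congr (Space.sigmaEquivIso e X)).1 (hI _ fun i => hX (e i))
  · intro _ X _
    exact properMorphisms_of_hom_initial (Limits.Sigma.desc fun j => PEmpty.elim j) _
  · intro J _ hJ _ X hX
    refine (Space.isCompact_congr (Space.sigmaOptionIso X)).1
      (Space.isCompact_sigma_bool H h fun b => ?_)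
    cases b
    exacts [hX none, hJ _ fun j => hX (some j)]

end

end Preneighbourhood

theorem mainTheorem3 {A : Type u} [CategoryTheory.Category.{v} A]
    [CategoryTheory.Limits.HasFiniteLimits A] [CategoryTheory.FinitaryExtensive A]
    (𝒜 : Preneighbourhood.Context A)
    (hclosed : ∀ {J : Type} [Finite J] (X Y : J → Preneighbourhood.Space 𝒜)
      (f : ∀ j, X j ⟶ Y j), (∀ j, Preneighbourhood.closedMorphisms 𝒜 (f j)) →
        Preneighbourhood.closedMorphisms 𝒜 (CategoryTheory.Limits.Sigma.map f)) :
    (∀ {J : Type} [Finite J] (X Y : J → Preneighbourhood.Space 𝒜)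
      (f : ∀ j, X j ⟶ Y j), (∀ j, Preneighbourhood.properMorphisms 𝒜 (f j)) →
        Preneighbourhood.properMorphisms 𝒜 (CategoryTheory.Limits.Sigma.map f)) ∧
    ((∀ {J : Type} [Finite J] (X : J → Preneighbourhood.Space 𝒜),
        (∀ j, (X j).IsCompact) → (∐ X).IsCompact) ↔
      ∀ X : Preneighbourhood.Space 𝒜,
        Preneighbourhood.properMorphisms 𝒜 (CategoryTheory.Limits.initial.to X) ∧
        Preneighbourhood.properMorphisms 𝒜 (CategoryTheory.Limits.codiag X)) := by
  have H {J : Type} [Finite J] (X Y : J → Preneighbourhood.Space 𝒜) (f : ∀ j, X j ⟶ Y j)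
      (hf : ∀ j, Preneighbourhood.properMorphisms 𝒜 (f j)) :
      Preneighbourhood.properMorphisms 𝒜 (Preneighbourhood.Space.sigmaMap f) :=
    Preneighbourhood.properMorphisms_sigmaMap (fun X Y f hf =>
      (Preneighbourhood.sigma_map_iff_sigmaMap _ f).1 (hclosed X Y f hf)) hf
  refine ⟨fun X Y f hf => (Preneighbourhood.sigma_map_iff_sigmaMap _ f).2 (H X Y f hf),
    fun h X => ⟨Preneighbourhood.properMorphisms_initial_to X, ?_⟩, fun h J _ X hX => ?_⟩
  · rw [Preneighbourhood.properMorphisms_codiag_iff]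
    refine Preneighbourhood.properMorphisms_fold terminalIsTerminal ?_ X
    -- The codiagonal of `1` is the map from `1 + 1` to the terminal space, so its properness is
    -- compactness of `1 + 1`.
    rw [← Preneighbourhood.Space.isCompact_iff terminalIsTerminal,
      ← Preneighbourhood.Space.isCompact_congr (Preneighbourhood.Space.sigmaIso _)]
    exact h _ fun _ => (Preneighbourhood.Space.isCompact_iff terminalIsTerminal (𝟙 _)).2
      (Preneighbourhood.properMorphisms_of_isIso _)
  · rw [Preneighbourhood.Space.isCompact_congr (Preneighbourhood.Space.sigmaIso X)]
    exact Preneighbourhood.Space.isCompact_sigma H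
      ((Preneighbourhood.properMorphisms_codiag_iff _).1 (h _).2) J X hX
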